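/- All objects are $C^\infty$. Let $(M,\Lambda,E)$ be a Jacobi manifold: $\Lambda$ is a bivector field and $E$ a vector field on the manifold $M$ such that $\{f,g\}=\Lambda(df,dg)+f\,Eg-g\,Ef$ is a Lie bracket on $C^\infty(M)$; it is a Poisson manifold if $E=0$. Let $(N,\nu N)$ be a normalized submanifold of $M$, that is, an embedded submanifold $N$ with a smooth subbundle $\nu N\subseteq TM|_N$ (a normal bundle) such that $TM|_N=TN\oplus\nu N$. A vector field $X$ on $M$ is normal to $N$ if $X|_N\in\Gamma(\nu N)$. Then $(N,\nu N)$ is called * an algebraically Jacobi-compatible (a.J.c.) submanifold if $E|_N$ is tangent to $N$ and, for every $\alpha\in\mathrm{ann}(\nu N)$, the vector $i(\alpha)\Lambda$ is tangent to $N$; * a Dirac submanifold if $\Lambda$ and $E$ are soldered to $(N,\nu N)$, that is, if it is an a.J.c. submanifold and in addition $(L_X\Lambda)|_{\mathrm{ann}(\nu N)}=0$ and $(L_XE)|_{\mathrm{ann}(\nu N)}=0$ for every vector field $X$ on $M$ that is normal to $N$. A Poisson manifold is treated as the Jacobi manifold with zero vector field. On $M\times\mathbb{R}$, with coordinate $\tau$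 on $\mathbb{R}$, consider the Poisson bivector field $$\Pi=e^{-\tau}\Big(\Lambda+\frac{\partial}{\partial\tau}\wedge E\Big),$$ and normalize $N\times\mathbb{R}\subseteq M\times\mathbb{R}$ by the lifted bundle $\tilde\nu$ with fibres $\tilde\nu_{(y,\tau)}=\nu_yN\times\{0\}$. **Proposition.** $(N\times\mathbb{R},\tilde\nu)$ is a normalized submanifold of $M\times\mathbb{R}$. Moreover, $(N,\nu N)$ is an a.J.c. submanifold of $(M,\Lambda,E)$ if and only if $(N\times\mathbb{R},\tilde\nu)$ is an a.J.c. submanifold of $(M\times\mathbb{R},\Pi)$, and $(N,\nu N)$ is a Dirac submanifold of $(M,\Lambda,E)$ if and only if $(N\times\mathbb{R},\tilde\nu)$ is a Dirac submanifold of $(M\times\mathbb{R},\Pi)$. -/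

import Mathlib

set_option maxSynthPendingDepth 3

open scoped Manifold ContDiff

noncomputable section

namespace JacobiDirac

section Tensors

variable {E : Type*} [NormedAddCommGroup E] [NormedSpace ℝ E]
  {H : Type*} [TopologicalSpace H] (I : ModelWithCorners ℝ E H)
  {M : Type*} [TopologicalSpace M] [ChartedSpace H M]

/-- The cotangent space `T*_x M`. -/
abbrev Cotangent (x : M) := TangentSpace I x →L[ℝ] ℝ

/-- The differential `df_x ∈ T*_x M` of a real function. -/
def differential (f : M → ℝ) (x : M) : Cotangent I x := mfderiv I 𝓘(ℝ, ℝ) f x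

/-- The derivative `X f` of a function along a vector field. -/
def derivAlong (X : ∀ x : M, TangentSpace I x) (f : M → ℝ) (x : M) : ℝ :=
  differential I f x (X x)

/-- Smoothness of a vector field, i.e. of a section of `TM`. -/
def SmoothVectorField [IsManifold I 1 M] (X : ∀ x : M, TangentSpace I x) : Prop :=
  ContMDiff I I.tangent ∞ (fun x => (⟨x, X x⟩ : TangentBundle I M))

/-- A bilinear form on each cotangent space. A bivector field is regarded as such a family
`(α, β) ↦ Λ(α, β)` which is alternating and smooth. -/
abbrev CotensorField (M : Type*) [TopologicalSpace M] [ChartedSpace H M] :=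
  ∀ x : M, Cotangent I x →L[ℝ] Cotangent I x →L[ℝ] ℝ

/-- `Λ` is a smooth bivector field: it is alternating, and smooth as a section of the bundle
`Hom(T*M, Hom(T*M, ℝ))`. -/
structure IsBivectorField [IsManifold I 1 M] (Λ : CotensorField I M) : Prop where
  alternating : ∀ (x : M) (α : Cotangent I x), Λ x α α = 0
  smooth : ContMDiff I (I.prod 𝓘(ℝ, (E →L[ℝ] ℝ) →L[ℝ] (E →L[ℝ] ℝ) →L[ℝ] ℝ)) ∞
    (fun x => Bundle.TotalSpace.mk' ((E →L[ℝ] ℝ) →L[ℝ] (E →L[ℝ] ℝ) →L[ℝ] ℝ)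
      (E := fun x : M => Cotangent I x →L[ℝ] Cotangent I x →L[ℝ] ℝ) x (Λ x))

variable {I}

/-- The value `Λ(df, dg)`, as a function on `M`. -/
def CotensorField.onFunctions (Λ : CotensorField I M) (f g : M → ℝ) (x : M) : ℝ :=
  Λ x (differential I f x) (differential I g x)

/-- The evaluation `α ↦ α(v)` on covectors. -/
def evalAt {x : M} (v : TangentSpace I x) : Cotangent I x →L[ℝ] ℝ :=
  (ContinuousLinearMap.apply ℝ ℝ (v : E) : (E →L[ℝ] ℝ) →L[ℝ] ℝ)

/-- The bivector `v ∧ w`. -/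
def wedge {x : M} (v w : TangentSpace I x) : Cotangent I x →L[ℝ] Cotangent I x →L[ℝ] ℝ :=
  (evalAt v).smulRight (evalAt w) - (evalAt w).smulRight (evalAt v)

/-- `(v ∧ w)(α, β) = α(v) β(w) - α(w) β(v)`. -/
theorem wedge_apply {x : M} (v w : TangentSpace I x) (α β : Cotangent I x) :
    wedge v w α β = α v * β w - α w * β v := rfl

/-- The value `(L_X Λ)(df, dg) = X(Λ(df, dg)) - Λ(d(Xf), dg) - Λ(df, d(Xg))` of the Lie derivative
of a bivector field, where `L_X df = d(Xf)` was used. -/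
def lieDerivative (X : ∀ x : M, TangentSpace I x) (Λ : CotensorField I M) (f g : M → ℝ)
    (x : M) : ℝ :=
  derivAlong I X (Λ.onFunctions f g) x - Λ.onFunctions (derivAlong I X f) g x
    - Λ.onFunctions f (derivAlong I X g) x

/-- The bracket `{f, g} = Λ(df, dg) + f (E g) - g (E f)`. -/
def jacobiBracket (Λ : CotensorField I M) (R : ∀ x : M, TangentSpace I x) (f g : M → ℝ)
    (x : M) : ℝ :=
  Λ.onFunctions f g x + f x * derivAlong I R g x - g x * derivAlong I R f x

/-- `(Λ, R)` is a Jacobi structure on `M`: `Λ` is a bivector field, `R` is a vector field (the one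
that is usually written `E`), and the bracket above is a Lie bracket on `C^∞(M)`. For `R = 0` this
says that `Λ` is a Poisson bivector field. -/
structure IsJacobiStructure [IsManifold I 1 M] (Λ : CotensorField I M)
    (R : ∀ x : M, TangentSpace I x) : Prop where
  bivector : IsBivectorField I Λ
  smooth : SmoothVectorField I R
  jacobi : ∀ f g h : M → ℝ, ContMDiff I 𝓘(ℝ, ℝ) ∞ f → ContMDiff I 𝓘(ℝ, ℝ) ∞ g →
    ContMDiff I 𝓘(ℝ, ℝ) ∞ h → ∀ x : M,
      jacobiBracket Λ R f (jacobiBracket Λ R g h) x + jacobiBracket Λ R g (jacobiBracket Λ R h f) x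
        + jacobiBracket Λ R h (jacobiBracket Λ R f g) x = 0

end Tensors

section Submanifolds

variable {E : Type*} [NormedAddCommGroup E] [NormedSpace ℝ E]
  {H : Type*} [TopologicalSpace H] (I : ModelWithCorners ℝ E H)
  {M : Type*} [TopologicalSpace M] [ChartedSpace H M]
  {E' : Type*} [NormedAddCommGroup E'] [NormedSpace ℝ E']
  {H' : Type*} [TopologicalSpace H'] (J : ModelWithCorners ℝ E' H')
  {N : Type*} [TopologicalSpace N] [ChartedSpace H' N]

/-- The subspace `T_yN` of `T_yM`, for a submanifold `ι : N → M`. -/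
def tangentTo (ι : N → M) (y : N) : Submodule ℝ (TangentSpace I (ι y)) :=
  LinearMap.range (mfderiv J I ι y).toLinearMap

/-- `(N, ν)` is a normalized submanifold of `M`: `ι : N → M` is a smooth embedding and `ν` is a
smooth subbundle of `TM|_N` (it has smooth local frames) with `TM|_N = TN ⊕ ν`. -/
structure IsNormalizedSubmanifold [IsManifold I 1 M] (ι : N → M)
    (ν : ∀ y : N, Submodule ℝ (TangentSpace I (ι y))) : Prop where
  embedding : Manifold.IsSmoothEmbedding J I ∞ ι
  isCompl : ∀ y : N, IsCompl (tangentTo I J ι y) (ν y)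
  smooth : ∀ y₀ : N, ∃ U : Set N, IsOpen U ∧ y₀ ∈ U ∧
    ∃ (k : ℕ) (s : Fin k → ∀ y : N, TangentSpace I (ι y)),
      (∀ i, ContMDiffOn J I.tangent ∞ (fun y => (⟨ι y, s i y⟩ : TangentBundle I M)) U) ∧
      ∀ y ∈ U, LinearIndependent ℝ (fun i => s i y) ∧
        Submodule.span ℝ (Set.range fun i => s i y) = ν y

variable {I}

/-- `α ∈ ann(ν_y)`. -/
def Annihilates {x : M} (α : Cotangent I x) (V : Submodule ℝ (TangentSpace I x)) : Prop :=
  ∀ v ∈ V, α v = 0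

/-- `X` is a vector field on `M` that is normal to `(N, ν)`. -/
def IsNormalField [IsManifold I 1 M] (ι : N → M) (ν : ∀ y : N, Submodule ℝ (TangentSpace I (ι y)))
    (X : ∀ x : M, TangentSpace I x) : Prop :=
  SmoothVectorField I X ∧ ∀ y : N, X (ι y) ∈ ν y

/-- A vector field is algebraically compatible with `(N, ν)` if it is tangent to `N`. -/
def VectorCompatible (ι : N → M) (R : ∀ x : M, TangentSpace I x) : Prop :=
  ∀ y : N, R (ι y) ∈ tangentTo I J ι y

/-- A bivector field is algebraically compatible with `(N, ν)` if for `α ∈ ann(ν)` the vector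
`i(α)Λ = Λ(α, ·)` is tangent to `N`. -/
def BivectorCompatible (ι : N → M) (ν : ∀ y : N, Submodule ℝ (TangentSpace I (ι y)))
    (Λ : CotensorField I M) : Prop :=
  ∀ (y : N) (α : Cotangent I (ι y)), Annihilates α (ν y) →
    ∃ w ∈ tangentTo I J ι y, ∀ β : Cotangent I (ι y), Λ (ι y) α β = β w

/-- A vector field `R` is soldered to `(N, ν)` if it is algebraically compatible and
`(L_X R)|_{ann(ν)} = 0` for every normal field `X`. -/
def VectorSoldered [IsManifold I 1 M] (ι : N → M)
    (ν : ∀ y : N, Submodule ℝ (TangentSpace I (ι y))) (R : ∀ x : M, TangentSpace I x) : Prop :=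
  VectorCompatible J ι R ∧
    ∀ X : ∀ x : M, TangentSpace I x, IsNormalField ι ν X →
      ∀ (y : N) (α : Cotangent I (ι y)), Annihilates α (ν y) →
        α (VectorField.mlieBracket I X R (ι y)) = 0

/-- A bivector field `Λ` is soldered to `(N, ν)` if it is algebraically compatible and
`(L_X Λ)|_{ann(ν)} = 0` for every normal field `X`. The covectors in `ann(ν_y)` are written as
differentials at `y` of smooth functions. -/
def BivectorSoldered [IsManifold I 1 M] (ι : N → M)
    (ν : ∀ y : N, Submodule ℝ (TangentSpace I (ι y))) (Λ : CotensorField I M) : Prop :=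
  BivectorCompatible J ι ν Λ ∧
    ∀ X : ∀ x : M, TangentSpace I x, IsNormalField ι ν X →
      ∀ (y : N) (f g : M → ℝ), ContMDiff I 𝓘(ℝ, ℝ) ∞ f → ContMDiff I 𝓘(ℝ, ℝ) ∞ g →
        Annihilates (differential I f (ι y)) (ν y) → Annihilates (differential I g (ι y)) (ν y) →
          lieDerivative X Λ f g (ι y) = 0

/-- `(N, ν)` is an algebraically Jacobi-compatible (a.J.c.) submanifold of `(M, Λ, R)`. -/
structure IsAJCSubmanifold [IsManifold I 1 M] (ι : N → M)
    (ν : ∀ y : N, Submodule ℝ (TangentSpace I (ι y))) (Λ : CotensorField I M)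
    (R : ∀ x : M, TangentSpace I x) : Prop where
  normalized : IsNormalizedSubmanifold I J ι ν
  bivector : BivectorCompatible J ι ν Λ
  vector : VectorCompatible J ι R

/-- `(N, ν)` is a Dirac submanifold of `(M, Λ, R)`. -/
structure IsDiracSubmanifold [IsManifold I 1 M] (ι : N → M)
    (ν : ∀ y : N, Submodule ℝ (TangentSpace I (ι y))) (Λ : CotensorField I M)
    (R : ∀ x : M, TangentSpace I x) : Prop where
  normalized : IsNormalizedSubmanifold I J ι ν
  bivector : BivectorSoldered J ι ν Λ
  vector : VectorSoldered J ι ν R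

end Submanifolds

section Product

variable {E : Type*} [NormedAddCommGroup E] [NormedSpace ℝ E]
  {H : Type*} [TopologicalSpace H] {I : ModelWithCorners ℝ E H}
  {M : Type*} [TopologicalSpace M] [ChartedSpace H M]

/-- The inclusion `T_xM → T_(x,τ)(M × ℝ)`, `v ↦ (v, 0)`. -/
def horizontal (p : M × ℝ) : TangentSpace I p.1 →L[ℝ] TangentSpace (I.prod 𝓘(ℝ, ℝ)) p :=
  ContinuousLinearMap.inl ℝ (TangentSpace I p.1) (TangentSpace 𝓘(ℝ, ℝ) p.2)

/-- The inclusion `v ↦ (v, 0)` is the differential of `x ↦ (x, τ)`. -/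
theorem horizontal_eq_mfderiv (x : M) (τ : ℝ) :
    horizontal (I := I) (x, τ) = mfderiv I (I.prod 𝓘(ℝ, ℝ)) (fun y : M => (y, τ)) x :=
  mfderiv_prod_left.symm

/-- The vector field `∂/∂τ` on `M × ℝ`. -/
def dTau (p : M × ℝ) : TangentSpace (I.prod 𝓘(ℝ, ℝ)) p :=
  ContinuousLinearMap.inr ℝ (TangentSpace I p.1) (TangentSpace 𝓘(ℝ, ℝ) p.2) (1 : ℝ)

/-- The field `∂/∂τ` is the velocity of the curve `τ ↦ (x, τ)`. -/
theorem dTau_eq_mfderiv (x : M) (τ : ℝ) :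
    dTau (I := I) (x, τ) =
      mfderiv 𝓘(ℝ, ℝ) (I.prod 𝓘(ℝ, ℝ)) (fun σ : ℝ => (x, σ)) τ (1 : ℝ) := by
  rw [mfderiv_prod_right]
  rfl

/-- The lift of a vector field of `M` to `M × ℝ`. -/
def liftVector (R : ∀ x : M, TangentSpace I x) (p : M × ℝ) :
    TangentSpace (I.prod 𝓘(ℝ, ℝ)) p :=
  horizontal p (R p.1)

/-- The lift of a bivector field of `M` to `M × ℝ` (the push-forward by `v ↦ (v, 0)`). -/
def liftBivector (Λ : CotensorField I M) : CotensorField (I.prod 𝓘(ℝ, ℝ)) (M × ℝ) :=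
  fun p =>
    let res : Cotangent (I.prod 𝓘(ℝ, ℝ)) p →L[ℝ] Cotangent I p.1 :=
      ContinuousLinearMap.precomp ℝ (horizontal p)
    (ContinuousLinearMap.precomp ℝ res).comp ((Λ p.1).comp res)

/-- The bivector field `Π = e^{-τ} (Λ + ∂/∂τ ∧ R)` on `M × ℝ`. -/
def poissonization (Λ : CotensorField I M) (R : ∀ x : M, TangentSpace I x) :
    CotensorField (I.prod 𝓘(ℝ, ℝ)) (M × ℝ) :=
  fun p => Real.exp (-p.2) • (liftBivector Λ p + wedge (dTau p) (liftVector R p))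

/-- The value `Π(α, β)` in terms of the components of `α` and `β`. -/
theorem poissonization_apply (Λ : CotensorField I M) (R : ∀ x : M, TangentSpace I x) (p : M × ℝ)
    (α β : Cotangent (I.prod 𝓘(ℝ, ℝ)) p) :
    poissonization Λ R p α β = Real.exp (-p.2) *
      (Λ p.1 (α.comp (horizontal p)) (β.comp (horizontal p)) +
        (α (dTau p) * β (horizontal p (R p.1)) - α (horizontal p (R p.1)) * β (dTau p))) := rfl

/-- The lift of a normal bundle `ν` of `N` to a normal bundle of `N × ℝ`, with fibre
`ν_y × {0}` at `(y, τ)`. -/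
def liftNormal {N : Type*} {ι : N → M} (ν : ∀ y : N, Submodule ℝ (TangentSpace I (ι y)))
    (q : N × ℝ) : Submodule ℝ (TangentSpace (I.prod 𝓘(ℝ, ℝ)) (Prod.map ι id q : M × ℝ)) :=
  (ν q.1).map (horizontal (I := I) (ι q.1, q.2)).toLinearMap

end Product

end JacobiDirac

end

/-!
The cotangent spaces of `M × ℝ` split: a covector at `(x, τ)` is `α + a dτ`, and it annihilates the
lifted normal bundle if and only if `α` annihilates `ν`, with `a` arbitrary. Contracting `Π` with such
a covector gives `e^{-τ} (i(α)Λ + a R - α(R) ∂/∂τ)`, which is tangent to `N × ℝ` for all `α` and `a`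
exactly when `(N, ν)` is algebraically compatible (`isAJCSubmanifold_prod_iff`).

For the Dirac condition, let `X` be a vector field on `M × ℝ` that is normal to `N × ℝ`, with
components `X_τ` along `M` and `φ` along `∂/∂τ`. For covectors `α`, `β` in `ann(ν)` and algebraically
compatible `(N, ν)`,
`(L_X Π)(α + a dτ, β + b dτ) = e^{-τ} ((L_{X_τ} Λ)(α, β) + a β([X_τ, R]) - b α([X_τ, R]))`
(`lieDerivative_poissonization_addTau`). The components that could disturb this formula drop out:
`X_τ ∈ ν` and `φ = 0` for all `τ` along `N`, so their `τ`-derivatives are killed by `ann(ν)`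
or vanish, and the differential of `φ` annihilates `TN`, hence also the tangent
vectors `i(β)Λ` and `R`. Every `X_τ` is a normal field on `M`, and every normal field on `M` lifts to one on `M × ℝ`; so the right-hand side
vanishes for all `X`, `α`, `β`, `a`, `b` if and only if `Λ` and `R` are soldered
(`isDiracSubmanifold_prod_iff`).

The Lie derivative of a bivector field is defined through differentials of functions. To replace an
arbitrary function on `M × ℝ` by one of the form `f + aτ` with the same differential at a point, it
is shown that `(L_X Λ)(df, dg)` is determined by the differentials at the point
(`lieDerivative_congr`). This follows from the commutator identity `X(Wf) - W(Xf) = df([X, W])`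
(`derivAlong_comm`) for the local vector field `W` with `Λ(·, dg) = W`.
-/

noncomputable section

namespace JacobiDirac

open Bundle Filter Topology VectorField

/-! ### Smoothness of contractions with differentials -/

section General

variable {E : Type*} [NormedAddCommGroup E] [NormedSpace ℝ E]
  {H : Type*} [TopologicalSpace H] {I : ModelWithCorners ℝ E H}
  {M : Type*} [TopologicalSpace M] [ChartedSpace H M] [IsManifold I ∞ M]
  {F : Type*} [NormedAddCommGroup F] [NormedSpace ℝ F]
  {G : Type*} [TopologicalSpace G] {K : ModelWithCorners ℝ F G}
  {P : Type*} [TopologicalSpace P] [ChartedSpace G P]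

/-- The partial differential `d_x f(q, ·)` at `x = b(q)` depends smoothly on the parameter `q`, as a
covector over `b`. -/
theorem contMDiffAt_differential_param [IsManifold K ∞ P] {f : P → M → ℝ} {b : P → M} {p : P}
    (hf : ContMDiffAt (K.prod I) 𝓘(ℝ, ℝ) ∞ (Function.uncurry f) (p, b p))
    (hb : ContMDiffAt K I ∞ b p) :
    ContMDiffAt K (I.prod 𝓘(ℝ, E →L[ℝ] ℝ)) ∞
      (fun q => TotalSpace.mk' (E →L[ℝ] ℝ) (E := fun x : M => Cotangent I x) (b q)
        (differential I (f q) (b q))) p := by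
  refine (contMDiffAt_hom_bundle (E₂ := Bundle.Trivial M ℝ) _).2 ⟨hb, ?_⟩
  have := ContMDiffAt.mfderiv (m := ∞) f b hf hb (by simp)
  refine this.congr_of_eventuallyEq (Eventually.of_forall fun q => ?_)
  simp only [inTangentCoordinates, ContinuousLinearMap.inCoordinates, differential]
  ext v
  simp
  rfl

theorem IsBivectorField.contMDiffAt_apply {Λ : CotensorField I M} (hΛ : IsBivectorField I Λ)
    {b : P → M} {p : P} (hb : ContMDiffAt K I ∞ b p) {α β : ∀ q : P, Cotangent I (b q)}
    (hα : ContMDiffAt K (I.prod 𝓘(ℝ, E →L[ℝ] ℝ)) ∞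
      (fun q => TotalSpace.mk' (E →L[ℝ] ℝ) (E := fun x : M => Cotangent I x) (b q) (α q)) p)
    (hβ : ContMDiffAt K (I.prod 𝓘(ℝ, E →L[ℝ] ℝ)) ∞
      (fun q => TotalSpace.mk' (E →L[ℝ] ℝ) (E := fun x : M => Cotangent I x) (b q) (β q)) p) :
    ContMDiffAt K 𝓘(ℝ, ℝ) ∞ (fun q => Λ (b q) (α q) (β q)) p := by
  have h1 := hΛ.smooth.contMDiffAt.comp p hb
  have := ContMDiffAt.clm_bundle_apply₂ (E₃ := Bundle.Trivial M ℝ) h1 hα hβ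
  simpa using (contMDiffAt_totalSpace.1 this).2

theorem SmoothVectorField.contMDiffAt_apply {X : ∀ x : M, TangentSpace I x}
    (hX : SmoothVectorField I X)
    {b : P → M} {p : P} (hb : ContMDiffAt K I ∞ b p) {α : ∀ q : P, Cotangent I (b q)}
    (hα : ContMDiffAt K (I.prod 𝓘(ℝ, E →L[ℝ] ℝ)) ∞
      (fun q => TotalSpace.mk' (E →L[ℝ] ℝ) (E := fun x : M => Cotangent I x) (b q) (α q)) p) :
    ContMDiffAt K 𝓘(ℝ, ℝ) ∞ (fun q => α q (X (b q))) p := by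
  have h1 := hX.contMDiffAt.comp p hb
  have := ContMDiffAt.clm_bundle_apply (E₂ := Bundle.Trivial M ℝ) hα h1
  simpa using (contMDiffAt_totalSpace.1 this).2

theorem contMDiffAt_differential {f : M → ℝ} {x : M} (hf : ContMDiffAt I 𝓘(ℝ, ℝ) ∞ f x) :
    ContMDiffAt I (I.prod 𝓘(ℝ, E →L[ℝ] ℝ)) ∞
      (fun z => TotalSpace.mk' (E →L[ℝ] ℝ) (E := fun x : M => Cotangent I x) z
        (differential I f z)) x :=
  contMDiffAt_differential_param (f := fun _ => f) (b := id)
    (ContMDiffAt.comp (x, x) hf contMDiffAt_snd) contMDiffAt_id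

theorem SmoothVectorField.contMDiffAt_derivAlong {X : ∀ x : M, TangentSpace I x}
    (hX : SmoothVectorField I X) {f : M → ℝ} {x : M} (hf : ContMDiffAt I 𝓘(ℝ, ℝ) ∞ f x) :
    ContMDiffAt I 𝓘(ℝ, ℝ) ∞ (derivAlong I X f) x :=
  hX.contMDiffAt_apply contMDiffAt_id (contMDiffAt_differential hf)

theorem IsBivectorField.contMDiffAt_onFunctions {Λ : CotensorField I M} (hΛ : IsBivectorField I Λ)
    {f g : M → ℝ} {x : M} (hf : ContMDiffAt I 𝓘(ℝ, ℝ) ∞ f x) (hg : ContMDiffAt I 𝓘(ℝ, ℝ) ∞ g x) :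
    ContMDiffAt I 𝓘(ℝ, ℝ) ∞ (Λ.onFunctions f g) x :=
  hΛ.contMDiffAt_apply contMDiffAt_id (contMDiffAt_differential hf) (contMDiffAt_differential hg)

end General

/-! ### The Lie bracket as a commutator of derivations -/

section Bracket

variable {E : Type*} [NormedAddCommGroup E] [NormedSpace ℝ E]
  {H : Type*} [TopologicalSpace H] {I : ModelWithCorners ℝ E H} [I.Boundaryless]
  {M : Type*} [TopologicalSpace M] [ChartedSpace H M]

/-- The commutator identity in a vector space: the second derivative of `F` drops out because it is
symmetric. -/
theorem fderiv_lieBracket {F : E → ℝ} {u : E} {V W : E → E} (hF : ContDiffAt ℝ 2 F u)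
    (hV : DifferentiableAt ℝ V u) (hW : DifferentiableAt ℝ W u) :
    fderiv ℝ (fun z => fderiv ℝ F z (W z)) u (V u) - fderiv ℝ (fun z => fderiv ℝ F z (V z)) u (W u)
      = fderiv ℝ F u (lieBracket ℝ V W u) := by
  have hd : DifferentiableAt ℝ (fderiv ℝ F) u :=
    (hF.fderiv_right (m := 1) (by norm_num)).differentiableAt one_ne_zero
  have hs : IsSymmSndFDerivAt ℝ F u := hF.isSymmSndFDerivAt (by simp)
  rw [fderiv_clm_apply hd hW, fderiv_clm_apply hd hV]
  simp only [lieBracket, add_apply, ContinuousLinearMap.comp_apply,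
    ContinuousLinearMap.flip_apply, map_sub, hs.eq (V u) (W u)]
  ring

theorem contDiffAt_comp_extChartAt_symm {f : M → ℝ} {x : M} (hf : ContMDiffAt I 𝓘(ℝ, ℝ) ∞ f x) :
    ContDiffAt ℝ ∞ (f ∘ (extChartAt I x).symm) (extChartAt I x x) := by
  have := (contMDiffAt_iff.1 hf).2
  rw [I.range_eq_univ, contDiffWithinAt_univ] at this
  exact this

/-- The representation of the vector field `W` in the extended chart at `x`: its pullback by the
inverse chart. This is the representation in terms of which `mlieBracket` at `x` is defined. -/
def inChart (I : ModelWithCorners ℝ E H) {M : Type*} [TopologicalSpace M] [ChartedSpace H M]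
    (x : M) (W : ∀ x : M, TangentSpace I x) : E → E :=
  mpullbackWithin 𝓘(ℝ, E) I (extChartAt I x).symm W (Set.range I)

variable [IsManifold I ∞ M]

theorem mdifferentiableAt_extChartAt_symm {x z : M} (hz : z ∈ (extChartAt I x).source) :
    MDifferentiableAt 𝓘(ℝ, E) I (extChartAt I x).symm (extChartAt I x z) := by
  have h1 := mdifferentiableWithinAt_extChartAt_symm (I := I) ((extChartAt I x).map_source hz)
  rwa [I.range_eq_univ, mdifferentiableWithinAt_univ] at h1

theorem fderiv_comp_extChartAt_symm {f : M → ℝ} {x z : M} (hz : z ∈ (extChartAt I x).source)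
    (hf : MDifferentiableAt I 𝓘(ℝ, ℝ) f z) (w : E) :
    fderiv ℝ (f ∘ (extChartAt I x).symm) (extChartAt I x z) w =
      differential I f z (mfderiv 𝓘(ℝ, E) I (extChartAt I x).symm (extChartAt I x z) w) := by
  have hz' := (extChartAt I x).left_inv hz
  rw [← mfderiv_eq_fderiv, mfderiv_comp (I' := I) _ (by rwa [hz'])
    (mdifferentiableAt_extChartAt_symm hz)]
  change mfderiv I 𝓘(ℝ, ℝ) f ((extChartAt I x).symm (extChartAt I x z)) _ = _
  rw [hz']
  rfl

theorem derivAlong_eq_fderiv {f : M → ℝ} {x z : M} (hz : z ∈ (extChartAt I x).source)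
    (hf : MDifferentiableAt I 𝓘(ℝ, ℝ) f z) (W : ∀ x : M, TangentSpace I x) :
    derivAlong I W f z =
      fderiv ℝ (f ∘ (extChartAt I x).symm) (extChartAt I x z)
        (inChart I x W (extChartAt I x z)) := by
  have h2 := isInvertible_mfderivWithin_extChartAt_symm (I := I) ((extChartAt I x).map_source hz)
  rw [I.range_eq_univ, mfderivWithin_univ] at h2
  rw [fderiv_comp_extChartAt_symm hz hf]
  simp only [inChart, mpullbackWithin_apply, I.range_eq_univ, mfderivWithin_univ]
  have h3 := h2.self_apply_inverse (W ((extChartAt I x).symm (extChartAt I x z)))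
  refine (congrArg (differential I f z) ?_).symm
  refine h3.trans ?_
  rw [(extChartAt I x).left_inv hz]

theorem mlieBracket_eq_mfderiv_symm (x : M) (V W : ∀ x : M, TangentSpace I x) :
    mlieBracket I V W x = mfderiv 𝓘(ℝ, E) I (extChartAt I x).symm (extChartAt I x x)
      (lieBracket ℝ (inChart I x V) (inChart I x W) (extChartAt I x x) : E) := by
  have hx := mem_extChartAt_source (I := I) x
  have h1 := isInvertible_mfderiv_extChartAt (I := I) hx
  have h2 := mfderivWithin_extChartAt_symm_comp_mfderiv_extChartAt' (I := I) hx
  rw [I.range_eq_univ, mfderivWithin_univ] at h2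
  have h3 : mlieBracket I V W x = (mfderiv I 𝓘(ℝ, E) (extChartAt I x) x).inverse
      (lieBracket ℝ (inChart I x V) (inChart I x W) (extChartAt I x x) : E) := by
    rw [← mlieBracketWithin_univ, mlieBracketWithin_apply, ← lieBracketWithin_univ,
      Set.preimage_univ, Set.univ_inter]
    simp only [inChart]
    rw [I.range_eq_univ]
  rw [h3]
  generalize (lieBracket ℝ (inChart I x V) (inChart I x W) (extChartAt I x x) : E) = A
  have h4 := h1.self_apply_inverse A
  have h5 := DFunLike.congr_fun h2 ((mfderiv I 𝓘(ℝ, E) (extChartAt I x) x).inverse A)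
  exact (h5.symm.trans (congrArg (mfderiv 𝓘(ℝ, E) I (extChartAt I x).symm (extChartAt I x x)) h4) :)

variable [FiniteDimensional ℝ E]

theorem differentiableAt_inChart {x : M} {V : ∀ x : M, TangentSpace I x}
    (hV : MDifferentiableAt I I.tangent (fun x => (⟨x, V x⟩ : TangentBundle I M)) x) :
    DifferentiableAt ℝ (inChart I x V) (extChartAt I x x) := by
  have := hV.mdifferentiableWithinAt (s := Set.univ) |>.differentiableWithinAt_mpullbackWithin_vectorField
  change DifferentiableWithinAt ℝ (inChart I x V) _ _ at this
  rwa [Set.preimage_univ, I.range_eq_univ, Set.univ_inter, differentiableWithinAt_univ] at this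

theorem derivAlong_derivAlong_eq_fderiv {f : M → ℝ} {x : M} {V W : ∀ x : M, TangentSpace I x}
    (hf : ContMDiffAt I 𝓘(ℝ, ℝ) ∞ f x)
    (hW : MDifferentiableAt I I.tangent (fun x => (⟨x, W x⟩ : TangentBundle I M)) x) :
    derivAlong I V (derivAlong I W f) x =
      fderiv ℝ (fun u => fderiv ℝ (f ∘ (extChartAt I x).symm) u (inChart I x W u))
        (extChartAt I x x) (inChart I x V (extChartAt I x x)) := by
  have hx := mem_extChartAt_source (I := I) x
  set F := f ∘ (extChartAt I x).symm
  set D : E → ℝ := fun u => fderiv ℝ F u (inChart I x W u)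
  have hF : DifferentiableAt ℝ (fderiv ℝ F) (extChartAt I x x) :=
    ((contDiffAt_comp_extChartAt_symm hf).fderiv_right (m := 1)
      (by norm_cast)).differentiableAt one_ne_zero
  have hD : DifferentiableAt ℝ D (extChartAt I x x) := hF.clm_apply (differentiableAt_inChart hW)
  have hev : derivAlong I W f =ᶠ[𝓝 x] D ∘ extChartAt I x := by
    have h1 : ∀ᶠ z in 𝓝 x, ContMDiffAt I 𝓘(ℝ, ℝ) 1 f z :=
      (contMDiffAt_iff_contMDiffAt_nhds (by simp)).1 (hf.of_le (by norm_cast))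
    filter_upwards [h1, extChartAt_source_mem_nhds (I := I) x] with z h1 h2
    exact derivAlong_eq_fderiv h2 (h1.mdifferentiableAt one_ne_zero) W
  have hm : MDifferentiableAt I 𝓘(ℝ, ℝ) (D ∘ extChartAt I x) x :=
    hD.mdifferentiableAt.comp x (mdifferentiableAt_extChartAt (mem_chart_source H x))
  have h3 : derivAlong I V (derivAlong I W f) x = derivAlong I V (D ∘ extChartAt I x) x := by
    simp only [derivAlong, differential]
    rw [hev.mfderiv_eq]
  rw [h3, derivAlong_eq_fderiv hx hm]
  refine congrArg (fun T : E →L[ℝ] ℝ => T _) (Filter.EventuallyEq.fderiv_eq ?_)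
  filter_upwards [extChartAt_target_mem_nhds (I := I) x] with u hu
  exact congrArg D ((extChartAt I x).right_inv hu)

/-- The commutator of two derivations along vector fields is the derivation along their Lie
bracket. -/
theorem derivAlong_comm {f : M → ℝ} {x : M} {V W : ∀ x : M, TangentSpace I x}
    (hf : ContMDiffAt I 𝓘(ℝ, ℝ) ∞ f x)
    (hV : MDifferentiableAt I I.tangent (fun x => (⟨x, V x⟩ : TangentBundle I M)) x)
    (hW : MDifferentiableAt I I.tangent (fun x => (⟨x, W x⟩ : TangentBundle I M)) x) :
    derivAlong I V (derivAlong I W f) x - derivAlong I W (derivAlong I V f) x =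
      differential I f x (mlieBracket I V W x) := by
  have hx := mem_extChartAt_source (I := I) x
  rw [derivAlong_derivAlong_eq_fderiv hf hW, derivAlong_derivAlong_eq_fderiv hf hV,
    fderiv_lieBracket ((contDiffAt_comp_extChartAt_symm hf).of_le (by norm_cast))
      (differentiableAt_inChart hV) (differentiableAt_inChart hW),
    fderiv_comp_extChartAt_symm hx (hf.mdifferentiableAt (by simp)), mlieBracket_eq_mfderiv_symm]

end Bracket

/-! ### The Lie derivative of a bivector field depends only on the differentials -/

section Antisymmetry

variable {E : Type*} [NormedAddCommGroup E] [NormedSpace ℝ E]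
  {H : Type*} [TopologicalSpace H] {I : ModelWithCorners ℝ E H}
  {M : Type*} [TopologicalSpace M] [ChartedSpace H M]

theorem CotensorField.onFunctions_swap {Λ : CotensorField I M}
    (hΛ : ∀ (x : M) (α : Cotangent I x), Λ x α α = 0) (f g : M → ℝ) (x : M) :
    Λ.onFunctions f g x = -Λ.onFunctions g f x := by
  have := hΛ x (differential I f x + differential I g x)
  simp only [map_add, add_apply, hΛ] at this
  simp only [onFunctions]
  linarith

theorem lieDerivative_swap {Λ : CotensorField I M}
    (hΛ : ∀ (x : M) (α : Cotangent I x), Λ x α α = 0) (X : ∀ x : M, TangentSpace I x)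
    (f g : M → ℝ) (x : M) : lieDerivative X Λ f g x = -lieDerivative X Λ g f x := by
  have h : Λ.onFunctions f g = -Λ.onFunctions g f := funext fun z => Λ.onFunctions_swap hΛ f g z
  have h2 : derivAlong I X (Λ.onFunctions f g) x = -derivAlong I X (Λ.onFunctions g f) x := by
    rw [h]
    simp only [derivAlong, differential]
    rw [mfderiv_neg]
    rfl
  rw [lieDerivative, lieDerivative, h2, Λ.onFunctions_swap hΛ _ g,
    Λ.onFunctions_swap hΛ f]
  ring

end Antisymmetry

section Tensoriality

variable {E : Type*} [NormedAddCommGroup E] [NormedSpace ℝ E]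
  {H : Type*} [TopologicalSpace H] {I : ModelWithCorners ℝ E H}
  {M : Type*} [TopologicalSpace M] [ChartedSpace H M]

theorem contMDiffAt_comp_extChartAt {x : M} (c : E →L[ℝ] ℝ) :
    ContMDiffAt I 𝓘(ℝ, ℝ) ∞ (c ∘ extChartAt I x) x :=
  c.contMDiff.contMDiffAt.comp x contMDiffAt_extChartAt

variable [IsManifold I ∞ M]

theorem differential_comp_extChartAt {x z : M} (hz : z ∈ (extChartAt I x).source) (c : E →L[ℝ] ℝ) :
    differential I (c ∘ extChartAt I x) z = c.comp (mfderiv I 𝓘(ℝ, E) (extChartAt I x) z) := by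
  have h := mfderiv_comp (I := I) (I' := 𝓘(ℝ, E)) (I'' := 𝓘(ℝ, ℝ)) z (g := c)
    c.differentiableAt.mdifferentiableAt
    (mdifferentiableAt_extChartAt (by simpa using hz))
  rw [ContinuousLinearMap.mfderiv_eq] at h
  exact h

variable [FiniteDimensional ℝ E]

/-- Every covector is the differential of a globally defined smooth function: a linear function in a
chart, cut off by a bump function. -/
theorem exists_differential_eq [T2Space M] (x : M) (α : Cotangent I x) :
    ∃ f : M → ℝ, ContMDiff I 𝓘(ℝ, ℝ) ∞ f ∧ differential I f x = α := by
  have hx := mem_extChartAt_source (I := I) x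
  have hinv := isInvertible_mfderiv_extChartAt (I := I) hx
  let c : E →L[ℝ] ℝ := α.comp (mfderiv I 𝓘(ℝ, E) (extChartAt I x) x).inverse
  obtain ⟨ψ⟩ : Nonempty (SmoothBumpFunction I x) := inferInstance
  refine ⟨fun z => ψ z • c (extChartAt I x z), ?_, ?_⟩
  · refine ψ.contMDiff_smul ?_
    exact c.contMDiff.comp_contMDiffOn contMDiffOn_extChartAt
  · have hev : (fun z => ψ z • c (extChartAt I x z)) =ᶠ[𝓝 x] c ∘ extChartAt I x := by
      filter_upwards [ψ.eventuallyEq_one] with z hz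
      simp [hz]
    have h1 : differential I (fun z => ψ z • c (extChartAt I x z)) x
        = differential I (c ∘ extChartAt I x) x := hev.mfderiv_eq
    rw [h1, differential_comp_extChartAt hx]
    ext v
    exact congrArg α (hinv.inverse_apply_self v)

/-- Near `x`, the contraction `Λ(·, dg)` is evaluation on a vector field `W`, the combination of the
coordinate fields with the coefficients `Λ(dxⁱ, dg)`. -/
theorem exists_vectorField_eq_contraction {Λ : CotensorField I M} {g : M → ℝ} {x : M}
    (hΛ : ∀ f : M → ℝ, ContMDiffAt I 𝓘(ℝ, ℝ) ∞ f x →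
      MDifferentiableAt I 𝓘(ℝ, ℝ) (Λ.onFunctions f g) x) :
    ∃ W : ∀ z : M, TangentSpace I z,
      MDifferentiableAt I I.tangent (fun z => (⟨z, W z⟩ : TangentBundle I M)) x ∧
        ∀ᶠ z in 𝓝 x, ∀ α : Cotangent I z, Λ z α (differential I g z) = α (W z) := by
  let b := Module.finBasis ℝ E
  let c : Fin (Module.finrank ℝ E) → E →L[ℝ] ℝ := fun i => (b.coord i).toContinuousLinearMap
  let e : Fin (Module.finrank ℝ E) → ∀ z : M, TangentSpace I z := fun i =>
    mpullback I 𝓘(ℝ, E) (extChartAt I x) (fun _ => b i)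
  have hx := mem_extChartAt_source (I := I) x
  refine ⟨fun z => ∑ i, Λ.onFunctions (c i ∘ extChartAt I x) g z • e i z, ?_, ?_⟩
  · refine MDifferentiableAt.sum_section fun i _ => ?_
    refine MDifferentiableAt.smul_section (hΛ _ (contMDiffAt_comp_extChartAt (c i))) ?_
    refine MDifferentiableAt.mpullback_vectorField (n := ∞) ?_ contMDiffAt_extChartAt
      (isInvertible_mfderiv_extChartAt hx) (by norm_cast)
    exact ((contMDiff_vectorSpace_iff_contDiff (n := 1)).2 contDiff_const).mdifferentiable
      one_ne_zero _
  · filter_upwards [extChartAt_source_mem_nhds (I := I) x] with z hz α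
    have hinv := isInvertible_mfderiv_extChartAt (I := I) hz
    -- the expansion of `α` in the coordinate covectors
    have hα : α = ∑ i, α (e i z) • differential I (c i ∘ extChartAt I x) z := by
      have h1 : α.comp (mfderiv I 𝓘(ℝ, E) (extChartAt I x) z).inverse
          = ∑ i, α (e i z) • (c i : E →L[ℝ] ℝ) := by
        refine ContinuousLinearMap.coe_injective (b.ext fun j => ?_)
        simp only [ContinuousLinearMap.coe_coe, sum_apply, smul_apply, c,
          LinearMap.coe_toContinuousLinearMap', Module.Basis.coord_apply, Module.Basis.repr_self,
          Finsupp.single_apply]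
        simp
        rfl
      ext v
      have h2 := DFunLike.congr_fun h1 (mfderiv I 𝓘(ℝ, E) (extChartAt I x) z v)
      have h3 := congrArg α (hinv.inverse_apply_self v)
      simp only [differential_comp_extChartAt hz]
      have h5 : ∀ w : E, (∑ i, α (e i z) • c i) w = ∑ i, α (e i z) * c i w := fun w => by
        simp only [sum_apply, smul_apply, smul_eq_mul]
      refine h3.symm.trans (h2.trans ((h5 _).trans ?_))
      simp only [sum_apply, smul_apply]
      rfl
    have h4 := congrArg (fun β : Cotangent I z => Λ z β (differential I g z)) hα
    simp only [map_sum, map_smul, sum_apply, smul_apply, smul_eq_mul] at h4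
    rw [h4, map_sum]
    refine Finset.sum_congr rfl fun i _ => ?_
    rw [map_smul, smul_eq_mul, mul_comm]
    rfl

variable [I.Boundaryless]

/-- With `Λ(·, dg) = W`, the second derivatives of `f` in `(L_X Λ)(df, dg)` enter only through the
commutator `X(Wf) - W(Xf) = df([X, W])`. -/
theorem lieDerivative_congr_left {Λ : CotensorField I M} {X : ∀ x : M, TangentSpace I x}
    (hX : SmoothVectorField I X) {f f' g : M → ℝ} {x : M}
    (hΛ : ∀ f : M → ℝ, ContMDiffAt I 𝓘(ℝ, ℝ) ∞ f x →
      MDifferentiableAt I 𝓘(ℝ, ℝ) (Λ.onFunctions f g) x)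
    (hf : ContMDiffAt I 𝓘(ℝ, ℝ) ∞ f x) (hf' : ContMDiffAt I 𝓘(ℝ, ℝ) ∞ f' x)
    (h : differential I f x = differential I f' x) :
    lieDerivative X Λ f g x = lieDerivative X Λ f' g x := by
  obtain ⟨W, hW, hWΛ⟩ := exists_vectorField_eq_contraction hΛ
  have key : ∀ f : M → ℝ, ContMDiffAt I 𝓘(ℝ, ℝ) ∞ f x → lieDerivative X Λ f g x =
      differential I f x (mlieBracket I X W x)
        - Λ x (differential I f x) (differential I (derivAlong I X g) x) := by
    intro f hf
    have hev : Λ.onFunctions f g =ᶠ[𝓝 x] derivAlong I W f := by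
      filter_upwards [hWΛ] with z hz using hz _
    have h1 : derivAlong I X (Λ.onFunctions f g) x = derivAlong I X (derivAlong I W f) x := by
      simp only [derivAlong, differential]
      rw [hev.mfderiv_eq]
    rw [← derivAlong_comm hf (hX.contMDiffAt.mdifferentiableAt (by simp)) hW, lieDerivative, h1]
    simp only [CotensorField.onFunctions, hWΛ.self_of_nhds]
    rfl
  rw [key f hf, key f' hf', h]

/-- The value `(L_X Λ)(df, dg)` at `x` depends only on the covectors `df_x` and `dg_x`. -/
theorem lieDerivative_congr {Λ : CotensorField I M} {X : ∀ x : M, TangentSpace I x}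
    (hX : SmoothVectorField I X) {f f' g g' : M → ℝ} {x : M}
    (halt : ∀ (x : M) (α : Cotangent I x), Λ x α α = 0)
    (hΛ : ∀ f g : M → ℝ, ContMDiffAt I 𝓘(ℝ, ℝ) ∞ f x → ContMDiffAt I 𝓘(ℝ, ℝ) ∞ g x →
      MDifferentiableAt I 𝓘(ℝ, ℝ) (Λ.onFunctions f g) x)
    (hf : ContMDiffAt I 𝓘(ℝ, ℝ) ∞ f x) (hf' : ContMDiffAt I 𝓘(ℝ, ℝ) ∞ f' x)
    (hg : ContMDiffAt I 𝓘(ℝ, ℝ) ∞ g x) (hg' : ContMDiffAt I 𝓘(ℝ, ℝ) ∞ g' x)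
    (hff' : differential I f x = differential I f' x)
    (hgg' : differential I g x = differential I g' x) :
    lieDerivative X Λ f g x = lieDerivative X Λ f' g' x := by
  rw [lieDerivative_congr_left hX (fun k hk => hΛ k g hk hg) hf hf' hff',
    lieDerivative_swap halt, lieDerivative_swap halt _ f' g',
    lieDerivative_congr_left hX (fun k hk => hΛ k f' hk hf') hg hg' hgg']

end Tensoriality

/-! ### Vectors, covectors and fields on `M × ℝ` -/

section ProductFields

variable {E : Type*} [NormedAddCommGroup E] [NormedSpace ℝ E]
  {H : Type*} [TopologicalSpace H] {I : ModelWithCorners ℝ E H}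
  {M : Type*} [TopologicalSpace M] [ChartedSpace H M]

/-- The projection `T_(x,τ)(M × ℝ) → T_xM`. -/
def baseComponent (p : M × ℝ) : TangentSpace (I.prod 𝓘(ℝ, ℝ)) p →L[ℝ] TangentSpace I p.1 :=
  ContinuousLinearMap.fst ℝ (TangentSpace I p.1) (TangentSpace 𝓘(ℝ, ℝ) p.2)

/-- The covector `dτ` on `M × ℝ`. -/
def tauComponent (p : M × ℝ) : Cotangent (I.prod 𝓘(ℝ, ℝ)) p :=
  ContinuousLinearMap.snd ℝ (TangentSpace I p.1) (TangentSpace 𝓘(ℝ, ℝ) p.2)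

@[simp] theorem baseComponent_horizontal (p : M × ℝ) (v : TangentSpace I p.1) :
    baseComponent p (horizontal p v) = v := rfl

@[simp] theorem tauComponent_horizontal (p : M × ℝ) (v : TangentSpace I p.1) :
    tauComponent p (horizontal p v) = 0 := rfl

@[simp] theorem baseComponent_dTau (p : M × ℝ) : baseComponent (I := I) p (dTau p) = 0 := rfl

@[simp] theorem tauComponent_dTau (p : M × ℝ) : tauComponent (I := I) p (dTau p) = 1 := rfl

theorem horizontal_add_dTau (p : M × ℝ) (z : TangentSpace (I.prod 𝓘(ℝ, ℝ)) p) :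
    horizontal p (baseComponent p z) + tauComponent p z • dTau p = z := by
  refine Prod.ext ?_ ?_
  · change (z : E × ℝ).1 + (z : E × ℝ).2 • (0 : E) = (z : E × ℝ).1
    simp
  · change (0 : ℝ) + (z : E × ℝ).2 • (1 : ℝ) = (z : E × ℝ).2
    simp

theorem baseComponent_horizontal_add_dTau (p : M × ℝ) (v : TangentSpace I p.1) (c : ℝ) :
    baseComponent p (horizontal p v + c • dTau p) = v := by
  simp

/-- The covector `α + a dτ` at `(x, τ)`, for a covector `α` at `x`. -/
def prodCovector (p : M × ℝ) (α : Cotangent I p.1) (a : ℝ) : Cotangent (I.prod 𝓘(ℝ, ℝ)) p :=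
  α.comp (baseComponent p) + a • tauComponent p

theorem prodCovector_apply (p : M × ℝ) (α : Cotangent I p.1) (a : ℝ)
    (z : TangentSpace (I.prod 𝓘(ℝ, ℝ)) p) :
    prodCovector p α a z = α (baseComponent p z) + a * tauComponent p z := rfl

theorem prodCovector_horizontal (p : M × ℝ) (α : Cotangent I p.1) (a : ℝ)
    (v : TangentSpace I p.1) : prodCovector p α a (horizontal p v) = α v := by
  simp [prodCovector_apply]

theorem prodCovector_comp_horizontal (p : M × ℝ) (α : Cotangent I p.1) (a : ℝ) :
    (prodCovector p α a).comp (horizontal p) = α :=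
  ContinuousLinearMap.ext (prodCovector_horizontal p α a)

theorem prodCovector_dTau (p : M × ℝ) (α : Cotangent I p.1) (a : ℝ) :
    prodCovector p α a (dTau p) = a := by
  simp [prodCovector_apply]

theorem eq_prodCovector (p : M × ℝ) (α : Cotangent (I.prod 𝓘(ℝ, ℝ)) p) :
    α = prodCovector p (α.comp (horizontal p)) (α (dTau p)) := by
  ext z
  conv_lhs => rw [← horizontal_add_dTau p z]
  simp only [map_add, map_smul, prodCovector_apply, ContinuousLinearMap.comp_apply,
    smul_eq_mul]
  ring

theorem poissonization_prodCovector (Λ : CotensorField I M) (R : ∀ x : M, TangentSpace I x)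
    (p : M × ℝ) (α β : Cotangent I p.1) (a b : ℝ) :
    poissonization Λ R p (prodCovector p α a) (prodCovector p β b) =
      Real.exp (-p.2) * (Λ p.1 α β + (a * β (R p.1) - b * α (R p.1))) := by
  rw [poissonization_apply]
  simp only [prodCovector_comp_horizontal, prodCovector_horizontal,
    prodCovector_dTau]
  ring

theorem differential_comp_horizontal {f : M × ℝ → ℝ} {p : M × ℝ}
    (hf : MDifferentiableAt (I.prod 𝓘(ℝ, ℝ)) 𝓘(ℝ, ℝ) f p) :
    (differential (I.prod 𝓘(ℝ, ℝ)) f p).comp (horizontal p) =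
      differential I (fun x => f (x, p.2)) p.1 := by
  obtain ⟨x, τ⟩ := p
  rw [horizontal_eq_mfderiv]
  exact (mfderiv_comp (I' := I.prod 𝓘(ℝ, ℝ)) x (g := f) (f := fun y : M => (y, τ)) hf
    (mdifferentiableAt_id.prodMk mdifferentiableAt_const)).symm

theorem differential_dTau {f : M × ℝ → ℝ} {p : M × ℝ}
    (hf : MDifferentiableAt (I.prod 𝓘(ℝ, ℝ)) 𝓘(ℝ, ℝ) f p) :
    differential (I.prod 𝓘(ℝ, ℝ)) f p (dTau p) = deriv (fun τ => f (p.1, τ)) p.2 := by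
  obtain ⟨x, τ⟩ := p
  rw [dTau_eq_mfderiv]
  have h := mfderiv_comp (I := 𝓘(ℝ, ℝ)) (I' := I.prod 𝓘(ℝ, ℝ)) τ (g := f)
    (f := fun t : ℝ => (x, t)) hf (mdifferentiableAt_const.prodMk mdifferentiableAt_id)
  rw [mfderiv_eq_fderiv] at h
  rw [← fderiv_apply_one_eq_deriv]
  exact (DFunLike.congr_fun h (1 : ℝ)).symm

theorem poissonization_alternating {Λ : CotensorField I M} (R : ∀ x : M, TangentSpace I x)
    (hΛ : ∀ (x : M) (α : Cotangent I x), Λ x α α = 0) (p : M × ℝ)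
    (α : Cotangent (I.prod 𝓘(ℝ, ℝ)) p) : poissonization Λ R p α α = 0 := by
  rw [poissonization_apply, hΛ]
  ring

/-- The function `f + aτ` on `M × ℝ`. -/
def addTau (f : M → ℝ) (a : ℝ) (p : M × ℝ) : ℝ := f p.1 + a * p.2

theorem contMDiff_addTau {f : M → ℝ} (hf : ContMDiff I 𝓘(ℝ, ℝ) ∞ f) (a : ℝ) :
    ContMDiff (I.prod 𝓘(ℝ, ℝ)) 𝓘(ℝ, ℝ) ∞ (addTau f a) :=
  (hf.comp contMDiff_fst).add (contMDiff_const.mul contMDiff_snd)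

theorem differential_addTau {f : M → ℝ} (hf : ContMDiff I 𝓘(ℝ, ℝ) ∞ f) (a : ℝ) (p : M × ℝ) :
    differential (I.prod 𝓘(ℝ, ℝ)) (addTau f a) p = prodCovector p (differential I f p.1) a := by
  have hd := (contMDiff_addTau hf a).mdifferentiable (by simp) p
  rw [eq_prodCovector p (differential (I.prod 𝓘(ℝ, ℝ)) (addTau f a) p),
    differential_comp_horizontal hd, differential_dTau hd]
  congr 1
  · have hc : MDifferentiableAt I 𝓘(ℝ, ℝ) (fun _ : M => a * p.2) p.1 := mdifferentiableAt_const
    refine (mfderiv_add (hf.mdifferentiable (by simp) p.1) hc).trans ?_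
    rw [mfderiv_const]
    exact add_zero _
  · simp [addTau]

variable [IsManifold I ∞ M]

theorem smoothVectorField_prod {X : ∀ x : M, TangentSpace I x} (hX : SmoothVectorField I X)
    (c : ℝ) : SmoothVectorField (I.prod 𝓘(ℝ, ℝ))
      (fun p : M × ℝ => horizontal p (X p.1) + c • dTau p) := by
  have h1 : ContMDiff (I.prod 𝓘(ℝ, ℝ)) I.tangent ∞
      (fun p : M × ℝ => (⟨p.1, X p.1⟩ : TangentBundle I M)) := hX.comp contMDiff_fst
  have h2 : ContMDiff (I.prod 𝓘(ℝ, ℝ)) (𝓘(ℝ, ℝ)).tangent ∞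
      (fun p : M × ℝ => (⟨p.2, c⟩ : TangentBundle 𝓘(ℝ, ℝ) ℝ)) :=
    ((contMDiff_vectorSpace_iff_contDiff (V := fun _ => c)).2 contDiff_const).comp contMDiff_snd
  have h3 := (contMDiff_equivTangentBundleProd_symm (n := ∞) (I := I) (I' := 𝓘(ℝ, ℝ)) (M := M)
    (M' := ℝ)).comp (h1.prodMk h2)
  refine h3.congr fun p => ?_
  refine congrArg (TotalSpace.mk p) (Prod.ext ?_ ?_)
  · have h (v : E) : v + c • (0 : E) = v := by simp
    exact h (X p.1)
  · change (0 : ℝ) + c * 1 = c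
    ring

theorem smoothVectorField_liftVector {X : ∀ x : M, TangentSpace I x} (hX : SmoothVectorField I X) :
    SmoothVectorField (I.prod 𝓘(ℝ, ℝ)) (liftVector (M := M) X) := by
  exact ContMDiff.congr (smoothVectorField_prod hX 0) fun p => by simp [liftVector]

theorem smoothVectorField_dTau : SmoothVectorField (I.prod 𝓘(ℝ, ℝ)) (dTau (I := I) (M := M)) := by
  have := smoothVectorField_prod (I := I) (M := M) (X := fun _ => 0)
    (contMDiff_zeroSection ℝ (TangentSpace I)) 1
  simpa using this

/-- The vector field `x ↦ X(x,τ)` on `M` obtained from the `M`-component of a vector field on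
`M × ℝ` at a fixed value of `τ`. -/
def sliceVector (X : ∀ p : M × ℝ, TangentSpace (I.prod 𝓘(ℝ, ℝ)) p) (τ : ℝ) (x : M) :
    TangentSpace I x :=
  baseComponent (x, τ) (X (x, τ))

theorem SmoothVectorField.sliceVector {X : ∀ p : M × ℝ, TangentSpace (I.prod 𝓘(ℝ, ℝ)) p}
    (hX : SmoothVectorField (I.prod 𝓘(ℝ, ℝ)) X) (τ : ℝ) :
    SmoothVectorField I (sliceVector X τ) := by
  have h1 : ContMDiff I (I.prod 𝓘(ℝ, ℝ)).tangent ∞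
      (fun x : M => (⟨(x, τ), X (x, τ)⟩ : TangentBundle (I.prod 𝓘(ℝ, ℝ)) (M × ℝ))) :=
    hX.comp (contMDiff_id.prodMk contMDiff_const)
  exact (contMDiff_fst.comp ((contMDiff_equivTangentBundleProd (n := ∞) (I := I) (I' := 𝓘(ℝ, ℝ))
    (M := M) (M' := ℝ)).comp h1) :)

/-- `Π(df, dg)` is smooth. The covectors `df` and `dg` are split into their components along `M`,
which are the differentials of `f(·, τ)` and `g(·, τ)`, and along `ℝ`. -/
theorem contMDiffAt_poissonization_onFunctions {Λ : CotensorField I M}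
    {R : ∀ x : M, TangentSpace I x} (hΛ : IsBivectorField I Λ) (hR : SmoothVectorField I R)
    {f g : M × ℝ → ℝ} {p : M × ℝ} (hf : ContMDiffAt (I.prod 𝓘(ℝ, ℝ)) 𝓘(ℝ, ℝ) ∞ f p)
    (hg : ContMDiffAt (I.prod 𝓘(ℝ, ℝ)) 𝓘(ℝ, ℝ) ∞ g p) :
    ContMDiffAt (I.prod 𝓘(ℝ, ℝ)) 𝓘(ℝ, ℝ) ∞ ((poissonization Λ R).onFunctions f g) p := by
  have hpar : ∀ f : M × ℝ → ℝ, ContMDiffAt (I.prod 𝓘(ℝ, ℝ)) 𝓘(ℝ, ℝ) ∞ f p →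
      ContMDiffAt (I.prod 𝓘(ℝ, ℝ)) (I.prod 𝓘(ℝ, E →L[ℝ] ℝ)) ∞
        (fun q : M × ℝ => TotalSpace.mk' (E →L[ℝ] ℝ) (E := fun x : M => Cotangent I x) q.1
          (differential I (fun x => f (x, q.2)) q.1)) p := by
    intro f hf
    have hc : ContMDiffAt ((I.prod 𝓘(ℝ, ℝ)).prod I) (I.prod 𝓘(ℝ, ℝ)) ∞
        (fun r : (M × ℝ) × M => (r.2, r.1.2)) (p, p.1) :=
      contMDiffAt_snd.prodMk (contMDiffAt_snd.comp _ contMDiffAt_fst)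
    exact contMDiffAt_differential_param (f := fun q x => f (x, q.2)) (b := Prod.fst)
      (ContMDiffAt.comp (I' := I.prod 𝓘(ℝ, ℝ)) (p, p.1) hf hc) contMDiffAt_fst
  have hdiff : ∀ f : M × ℝ → ℝ, ContMDiffAt (I.prod 𝓘(ℝ, ℝ)) 𝓘(ℝ, ℝ) ∞ f p →
      ∀ᶠ q in 𝓝 p, MDifferentiableAt (I.prod 𝓘(ℝ, ℝ)) 𝓘(ℝ, ℝ) f q := by
    intro f hf
    have h1 := (contMDiffAt_iff_contMDiffAt_nhds (n := 1) (by simp)).1 (hf.of_le (by norm_cast))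
    filter_upwards [h1] with q hq using hq.mdifferentiableAt one_ne_zero
  have hexp : ContMDiffAt (I.prod 𝓘(ℝ, ℝ)) 𝓘(ℝ, ℝ) ∞ (fun q : M × ℝ => Real.exp (-q.2)) p :=
    (Real.contDiff_exp.comp contDiff_neg).contMDiff.contMDiffAt.comp p contMDiffAt_snd
  have hL := smoothVectorField_liftVector hR
  have hT := smoothVectorField_dTau (I := I) (M := M)
  have := hexp.mul ((hΛ.contMDiffAt_apply contMDiffAt_fst (hpar f hf) (hpar g hg)).add
    (((hT.contMDiffAt_derivAlong hf).mul (hL.contMDiffAt_derivAlong hg)).sub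
      ((hL.contMDiffAt_derivAlong hf).mul (hT.contMDiffAt_derivAlong hg))))
  refine this.congr_of_eventuallyEq ?_
  filter_upwards [hdiff f hf, hdiff g hg] with q hfq hgq
  rw [CotensorField.onFunctions, poissonization_apply, differential_comp_horizontal hfq,
    differential_comp_horizontal hgq]
  rfl

end ProductFields

/-! ### The submanifold `N × ℝ` -/

section Submanifold

variable {E : Type*} [NormedAddCommGroup E] [NormedSpace ℝ E]
  {H : Type*} [TopologicalSpace H] {I : ModelWithCorners ℝ E H}
  {M : Type*} [TopologicalSpace M] [ChartedSpace H M]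
  {E' : Type*} [NormedAddCommGroup E'] [NormedSpace ℝ E']
  {H' : Type*} [TopologicalSpace H'] {J : ModelWithCorners ℝ E' H'}
  {N : Type*} {ι : N → M} {ν : ∀ y : N, Submodule ℝ (TangentSpace I (ι y))}

theorem horizontal_mem_liftNormal {y : N} {τ : ℝ} {v : TangentSpace I (ι y)} (hv : v ∈ ν y) :
    horizontal (ι y, τ) v ∈ liftNormal ν (y, τ) :=
  Submodule.mem_map_of_mem hv

theorem mem_liftNormal_iff {q : N × ℝ} {z : TangentSpace (I.prod 𝓘(ℝ, ℝ)) (ι q.1, q.2)} :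
    z ∈ liftNormal ν q ↔
      baseComponent (ι q.1, q.2) z ∈ ν q.1 ∧ tauComponent (ι q.1, q.2) z = 0 := by
  constructor
  · rintro ⟨v, hv, rfl⟩
    exact ⟨hv, rfl⟩
  · rintro ⟨h1, h2⟩
    have := horizontal_add_dTau (I := I) (ι q.1, q.2) z
    rw [h2, zero_smul, add_zero] at this
    rw [← this]
    exact horizontal_mem_liftNormal h1

/-- A vector field on `M × ℝ` is normal to `N × ℝ` if and only if, along `N × ℝ`, its `M`-component
lies in `ν` and its `∂/∂τ`-component vanishes. -/
theorem isNormalField_prod_iff [IsManifold I ∞ M]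
    {X : ∀ p : M × ℝ, TangentSpace (I.prod 𝓘(ℝ, ℝ)) p} :
    IsNormalField (Prod.map ι id : N × ℝ → M × ℝ) (liftNormal ν) X ↔
      SmoothVectorField (I.prod 𝓘(ℝ, ℝ)) X ∧ ∀ (y : N) (τ : ℝ), sliceVector X τ (ι y) ∈ ν y ∧
        tauComponent (ι y, τ) (X (ι y, τ)) = 0 := by
  refine and_congr_right fun _ => ⟨fun h y τ => ?_, fun h q => ?_⟩
  · exact mem_liftNormal_iff.1 (h (y, τ))
  · exact mem_liftNormal_iff.2 (h q.1 q.2)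

variable [TopologicalSpace N] [ChartedSpace H' N]

theorem mem_tangentTo_prod_iff (hι : MDifferentiable J I ι) {q : N × ℝ}
    {z : TangentSpace (I.prod 𝓘(ℝ, ℝ)) (ι q.1, q.2)} :
    z ∈ tangentTo (I.prod 𝓘(ℝ, ℝ)) (J.prod 𝓘(ℝ, ℝ)) (Prod.map ι id : N × ℝ → M × ℝ) q ↔
      baseComponent (ι q.1, q.2) z ∈ tangentTo I J ι q.1 := by
  have h : mfderiv (J.prod 𝓘(ℝ, ℝ)) (I.prod 𝓘(ℝ, ℝ)) (Prod.map ι id : N × ℝ → M × ℝ) q =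
      (mfderiv J I ι q.1).prodMap (mfderiv 𝓘(ℝ, ℝ) 𝓘(ℝ, ℝ) id q.2) :=
    mfderiv_prodMap (hι q.1) mdifferentiableAt_id
  constructor
  · rintro ⟨w, rfl⟩
    refine ⟨baseComponent q w, ?_⟩
    change _ = baseComponent (ι q.1, q.2) (mfderiv (J.prod 𝓘(ℝ, ℝ)) (I.prod 𝓘(ℝ, ℝ))
      (Prod.map ι id : N × ℝ → M × ℝ) q w)
    rw [h]
    rfl
  · rintro ⟨w, hw⟩
    refine ⟨((w, tauComponent (ι q.1, q.2) z) : E' × ℝ), ?_⟩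
    change mfderiv (J.prod 𝓘(ℝ, ℝ)) (I.prod 𝓘(ℝ, ℝ)) (Prod.map ι id : N × ℝ → M × ℝ) q _ = z
    rw [h, mfderiv_id]
    exact Prod.ext hw rfl

/-- The differential of a function that vanishes on `N` annihilates the tangent vectors of `N`. -/
theorem differential_apply_tangentTo {f : M → ℝ} {y : N} (hι : MDifferentiable J I ι)
    (hf : MDifferentiableAt I 𝓘(ℝ, ℝ) f (ι y)) (h : ∀ y, f (ι y) = 0) {w : TangentSpace I (ι y)}
    (hw : w ∈ tangentTo I J ι y) : differential I f (ι y) w = 0 := by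
  obtain ⟨u, rfl⟩ := hw
  have h1 := mfderiv_comp (I'' := 𝓘(ℝ, ℝ)) y (g := f) hf (hι y)
  have h2 : f ∘ ι = fun _ => 0 := funext h
  rw [h2, mfderiv_const] at h1
  exact (DFunLike.congr_fun h1 u).symm

theorem poissonization_onFunctions_addTau [IsManifold I ∞ M] (Λ : CotensorField I M)
    (R : ∀ x : M, TangentSpace I x) {f g : M → ℝ} (hf : ContMDiff I 𝓘(ℝ, ℝ) ∞ f)
    (hg : ContMDiff I 𝓘(ℝ, ℝ) ∞ g) (a b : ℝ) (p : M × ℝ) :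
    (poissonization Λ R).onFunctions (addTau f a) (addTau g b) p = Real.exp (-p.2) *
      (Λ.onFunctions f g p.1 + (a * derivAlong I R g p.1 - b * derivAlong I R f p.1)) := by
  rw [CotensorField.onFunctions, differential_addTau hf, differential_addTau hg,
    poissonization_prodCovector]
  rfl

theorem derivAlong_addTau [IsManifold I ∞ M] {f : M → ℝ} (hf : ContMDiff I 𝓘(ℝ, ℝ) ∞ f) (a : ℝ)
    (X : ∀ p : M × ℝ, TangentSpace (I.prod 𝓘(ℝ, ℝ)) p) (p : M × ℝ) :
    derivAlong (I.prod 𝓘(ℝ, ℝ)) X (addTau f a) p =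
      derivAlong I (sliceVector X p.2) f p.1 + a * tauComponent p (X p) := by
  rw [derivAlong, differential_addTau hf]
  rfl

end Submanifold

/-! ### The Lie derivative of the Poisson bivector field along a normal field -/

section Formula

variable {E : Type*} [NormedAddCommGroup E] [NormedSpace ℝ E]
  {H : Type*} [TopologicalSpace H] {I : ModelWithCorners ℝ E H}
  {M : Type*} [TopologicalSpace M] [ChartedSpace H M] [IsManifold I ∞ M]
  {E' : Type*} [NormedAddCommGroup E'] [NormedSpace ℝ E']
  {H' : Type*} [TopologicalSpace H'] {J : ModelWithCorners ℝ E' H'}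
  {N : Type*} [TopologicalSpace N] [ChartedSpace H' N]
  {ι : N → M} {ν : ∀ y : N, Submodule ℝ (TangentSpace I (ι y))}
  {Λ : CotensorField I M} {R : ∀ x : M, TangentSpace I x}

theorem contMDiff_tauComponent {X : ∀ p : M × ℝ, TangentSpace (I.prod 𝓘(ℝ, ℝ)) p}
    (hX : SmoothVectorField (I.prod 𝓘(ℝ, ℝ)) X) :
    ContMDiff (I.prod 𝓘(ℝ, ℝ)) 𝓘(ℝ, ℝ) ∞ fun p => tauComponent p (X p) := by
  have h0 : ContMDiff I 𝓘(ℝ, ℝ) ∞ (fun _ : M => (0 : ℝ)) := contMDiff_const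
  intro p
  have h := hX.contMDiffAt_derivAlong (contMDiff_addTau h0 1 p)
  refine h.congr_of_eventuallyEq (Eventually.of_forall fun q => ?_)
  dsimp only
  rw [derivAlong_addTau h0]
  have h1 : derivAlong I (sliceVector X q.2) (fun _ => (0 : ℝ)) q.1 = 0 := by
    rw [derivAlong, differential, mfderiv_const]
    rfl
  rw [h1, one_mul, zero_add]

/-- For `X` normal to `N × ℝ` and `df` annihilating `ν`, the differential of `X(f + aτ)` at `(y, τ)`
is `d(X_τ f) + a dφ`, where `X_τ` and `φ` are the components of `X` at the level `τ`; there is no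
`dτ`-term because `X(f + aτ)` vanishes on the line `{y} × ℝ`. The covector `dφ` annihilates `TN`, so
algebraic compatibility removes its contribution. -/
theorem poissonization_onFunctions_derivAlong_addTau
    (halt : ∀ (x : M) (α : Cotangent I x), Λ x α α = 0) (hι : MDifferentiable J I ι)
    (hΛ : BivectorCompatible J ι ν Λ) (hR : VectorCompatible J ι R)
    {X : ∀ p : M × ℝ, TangentSpace (I.prod 𝓘(ℝ, ℝ)) p}
    (hX : IsNormalField (Prod.map ι id : N × ℝ → M × ℝ) (liftNormal ν) X)
    {f g : M → ℝ} (hf : ContMDiff I 𝓘(ℝ, ℝ) ∞ f) (hg : ContMDiff I 𝓘(ℝ, ℝ) ∞ g) (a b : ℝ) (y : N)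
    (τ : ℝ) (hfν : Annihilates (differential I f (ι y)) (ν y))
    (hgν : Annihilates (differential I g (ι y)) (ν y)) :
    (poissonization Λ R).onFunctions (derivAlong (I.prod 𝓘(ℝ, ℝ)) X (addTau f a)) (addTau g b)
      (ι y, τ) = Real.exp (-τ) *
        (Λ.onFunctions (derivAlong I (sliceVector X τ) f) g (ι y) -
          b * derivAlong I R (derivAlong I (sliceVector X τ) f) (ι y)) := by
  obtain ⟨hXs, hXν⟩ := isNormalField_prod_iff.1 hX
  have hd : MDifferentiableAt (I.prod 𝓘(ℝ, ℝ)) 𝓘(ℝ, ℝ)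
      (derivAlong (I.prod 𝓘(ℝ, ℝ)) X (addTau f a)) (ι y, τ) :=
    (hXs.contMDiffAt_derivAlong (contMDiff_addTau hf a _)).mdifferentiableAt (by simp)
  -- the `τ`-component of `X` at the level `τ`
  set φ : M → ℝ := fun x => tauComponent (x, τ) (X (x, τ)) with hφ
  have hφs : MDifferentiable I 𝓘(ℝ, ℝ) φ :=
    ((contMDiff_tauComponent hXs).comp (contMDiff_id.prodMk contMDiff_const)).mdifferentiable
      (by simp)
  have hφ0 : ∀ w ∈ tangentTo I J ι y, differential I φ (ι y) w = 0 := fun w hw =>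
    differential_apply_tangentTo hι (hφs _) (fun y => (hXν y τ).2) hw
  have hsl : MDifferentiableAt I 𝓘(ℝ, ℝ) (derivAlong I (sliceVector X τ) f) (ι y) :=
    ((hXs.sliceVector τ).contMDiffAt_derivAlong hf.contMDiffAt).mdifferentiableAt (by simp)
  have h1 : differential (I.prod 𝓘(ℝ, ℝ)) (derivAlong (I.prod 𝓘(ℝ, ℝ)) X (addTau f a)) (ι y, τ) =
      prodCovector (ι y, τ)
        (differential I (derivAlong I (sliceVector X τ) f) (ι y) + a • differential I φ (ι y)) 0 := by
    rw [eq_prodCovector (ι y, τ) (differential (I.prod 𝓘(ℝ, ℝ)) _ (ι y, τ)),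
      differential_comp_horizontal hd, differential_dTau hd]
    congr 1
    · have h : (fun x => derivAlong (I.prod 𝓘(ℝ, ℝ)) X (addTau f a) (x, τ)) =
          derivAlong I (sliceVector X τ) f + a • φ := by
        funext x
        rw [derivAlong_addTau hf]
        rfl
      simp only [differential]
      rw [h, mfderiv_add hsl ((hφs _).const_smul a), const_smul_mfderiv (hφs _)]
      rfl
    · have h : (fun t => derivAlong (I.prod 𝓘(ℝ, ℝ)) X (addTau f a) (ι y, t)) = fun _ => 0 := by
        funext t
        rw [derivAlong_addTau hf, (hXν y t).2, mul_zero, add_zero]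
        exact hfν _ (hXν y t).1
      rw [h, deriv_const]
  have h5 : Λ (ι y) (differential I φ (ι y)) (differential I g (ι y)) = 0 := by
    obtain ⟨w, hw, hwΛ⟩ := hΛ y _ hgν
    have hs := halt (ι y) (differential I φ (ι y) + differential I g (ι y))
    simp only [map_add, add_apply, halt, hwΛ, hφ0 w hw] at hs
    simpa using hs
  rw [CotensorField.onFunctions, h1, differential_addTau hg, poissonization_prodCovector]
  simp only [add_apply, smul_apply, map_add, map_smul, h5, hφ0 _ (hR y), smul_zero, add_zero,
    zero_mul, zero_sub, CotensorField.onFunctions, derivAlong]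
  ring

/-- For `X` normal to `N × ℝ`, with `M`-component `X_τ` at the level `τ`, and `df`, `dg` annihilating
`ν`, this is the identity
`(L_X Π)(df + a dτ, dg + b dτ) = e^{-τ} ((L_{X_τ} Λ)(df, dg) + a dg([X_τ, R]) - b df([X_τ, R]))`,
with `[X_τ, R]` written as a commutator of derivations. -/
theorem lieDerivative_poissonization_addTau (hbi : IsBivectorField I Λ)
    (hRs : SmoothVectorField I R) (hι : MDifferentiable J I ι)
    (hΛ : BivectorCompatible J ι ν Λ) (hR : VectorCompatible J ι R)
    {X : ∀ p : M × ℝ, TangentSpace (I.prod 𝓘(ℝ, ℝ)) p}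
    (hX : IsNormalField (Prod.map ι id : N × ℝ → M × ℝ) (liftNormal ν) X)
    {f g : M → ℝ} (hf : ContMDiff I 𝓘(ℝ, ℝ) ∞ f) (hg : ContMDiff I 𝓘(ℝ, ℝ) ∞ g) (a b : ℝ) (y : N)
    (τ : ℝ) (hfν : Annihilates (differential I f (ι y)) (ν y))
    (hgν : Annihilates (differential I g (ι y)) (ν y)) :
    lieDerivative X (poissonization Λ R) (addTau f a) (addTau g b) (ι y, τ) = Real.exp (-τ) *
      (lieDerivative (sliceVector X τ) Λ f g (ι y)
        + a * (derivAlong I (sliceVector X τ) (derivAlong I R g) (ι y)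
          - derivAlong I R (derivAlong I (sliceVector X τ) g) (ι y))
        - b * (derivAlong I (sliceVector X τ) (derivAlong I R f) (ι y)
          - derivAlong I R (derivAlong I (sliceVector X τ) f) (ι y))) := by
  obtain ⟨hXs, hXν⟩ := isNormalField_prod_iff.1 hX
  have halt := hbi.alternating
  have h1 : derivAlong (I.prod 𝓘(ℝ, ℝ)) X
      ((poissonization Λ R).onFunctions (addTau f a) (addTau g b)) (ι y, τ) = Real.exp (-τ) *
        (derivAlong I (sliceVector X τ) (Λ.onFunctions f g) (ι y)
          + a * derivAlong I (sliceVector X τ) (derivAlong I R g) (ι y)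
          - b * derivAlong I (sliceVector X τ) (derivAlong I R f) (ι y)) := by
    have hd : MDifferentiableAt (I.prod 𝓘(ℝ, ℝ)) 𝓘(ℝ, ℝ)
        ((poissonization Λ R).onFunctions (addTau f a) (addTau g b)) (ι y, τ) :=
      (contMDiffAt_poissonization_onFunctions hbi hRs (contMDiff_addTau hf a _)
        (contMDiff_addTau hg b _)).mdifferentiableAt (by simp)
    -- on `N × ℝ` the field `X` is horizontal, so only the level `τ` matters
    have hv : X (ι y, τ) = horizontal (ι y, τ) (sliceVector X τ (ι y)) := by
      have := horizontal_add_dTau (ι y, τ) (X (ι y, τ))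
      rw [(hXν y τ).2, zero_smul, add_zero] at this
      exact this.symm
    have hh := DFunLike.congr_fun (differential_comp_horizontal hd) (sliceVector X τ (ι y))
    rw [derivAlong, hv]
    refine hh.trans ?_
    have hfun : (fun x => (poissonization Λ R).onFunctions (addTau f a) (addTau g b) (x, τ)) =
        Real.exp (-τ) • (Λ.onFunctions f g + (a • derivAlong I R g - b • derivAlong I R f)) :=
      funext fun x => poissonization_onFunctions_addTau Λ R hf hg a b (x, τ)
    have d1 : MDifferentiableAt I 𝓘(ℝ, ℝ) (Λ.onFunctions f g) (ι y) :=
      (hbi.contMDiffAt_onFunctions hf.contMDiffAt hg.contMDiffAt).mdifferentiableAt (by simp)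
    have d2 : ∀ {k : M → ℝ}, ContMDiff I 𝓘(ℝ, ℝ) ∞ k →
        MDifferentiableAt I 𝓘(ℝ, ℝ) (derivAlong I R k) (ι y) := fun hk =>
      (hRs.contMDiffAt_derivAlong hk.contMDiffAt).mdifferentiableAt (by simp)
    simp only [differential]
    rw [hfun, const_smul_mfderiv (d1.add (((d2 hg).const_smul a).sub ((d2 hf).const_smul b))),
      mfderiv_add d1 (((d2 hg).const_smul a).sub ((d2 hf).const_smul b)),
      mfderiv_sub ((d2 hg).const_smul a) ((d2 hf).const_smul b), const_smul_mfderiv (d2 hg),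
      const_smul_mfderiv (d2 hf)]
    have : ∀ A B C : E →L[ℝ] ℝ, ∀ v : E, (Real.exp (-τ) • (A + (a • B - b • C))) v =
        Real.exp (-τ) * (A v + a * B v - b * C v) := by
      intro A B C v
      simp only [smul_apply, add_apply, sub_apply, smul_eq_mul]
      ring
    exact this _ _ _ _
  have h2 := poissonization_onFunctions_derivAlong_addTau halt hι hΛ hR hX hf hg a b y τ hfν hgν
  have h3 := poissonization_onFunctions_derivAlong_addTau halt hι hΛ hR hX hg hf b a y τ hgν hfν
  rw [lieDerivative, h1, h2, (poissonization Λ R).onFunctions_swap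
    (poissonization_alternating R halt) (addTau f a), h3, lieDerivative,
    Λ.onFunctions_swap halt f]
  ring

end Formula

/-! ### The equivalences -/

section Equivalence

variable {E : Type*} [NormedAddCommGroup E] [NormedSpace ℝ E]
  {H : Type*} [TopologicalSpace H] {I : ModelWithCorners ℝ E H}
  {M : Type*} [TopologicalSpace M] [ChartedSpace H M]
  {E' : Type*} [NormedAddCommGroup E'] [NormedSpace ℝ E']
  {H' : Type*} [TopologicalSpace H'] {J : ModelWithCorners ℝ E' H'}
  {N : Type*} [TopologicalSpace N] [ChartedSpace H' N]
  {ι : N → M} {ν : ∀ y : N, Submodule ℝ (TangentSpace I (ι y))}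
  {Λ : CotensorField I M} {R : ∀ x : M, TangentSpace I x}

theorem isCompl_tangentTo_liftNormal (hι : MDifferentiable J I ι)
    (h : ∀ y : N, IsCompl (tangentTo I J ι y) (ν y)) (q : N × ℝ) :
    IsCompl (tangentTo (I.prod 𝓘(ℝ, ℝ)) (J.prod 𝓘(ℝ, ℝ)) (Prod.map ι id : N × ℝ → M × ℝ) q)
      (liftNormal ν q) := by
  constructor
  · rw [Submodule.disjoint_def]
    intro z hz hz'
    obtain ⟨h1, h2⟩ := mem_liftNormal_iff.1 hz'
    have h3 := Submodule.disjoint_def.1 (h q.1).disjoint _ ((mem_tangentTo_prod_iff hι).1 hz) h1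
    exact Prod.ext h3 h2
  · rw [codisjoint_iff, Submodule.eq_top_iff']
    intro z
    have h1 : baseComponent (I := I) (ι q.1, q.2) z ∈ tangentTo I J ι q.1 ⊔ ν q.1 := by
      rw [(h q.1).sup_eq_top]; trivial
    obtain ⟨u, hu, v, hv, huv⟩ := Submodule.mem_sup.1 h1
    refine Submodule.mem_sup.2 ⟨horizontal (ι q.1, q.2) u +
      tauComponent (I := I) (ι q.1, q.2) z • dTau (ι q.1, q.2), ?_, horizontal (ι q.1, q.2) v,
      horizontal_mem_liftNormal hv, ?_⟩
    · rw [mem_tangentTo_prod_iff hι, baseComponent_horizontal_add_dTau]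
      exact hu
    · have h2 := horizontal_add_dTau (I := I) (ι q.1, q.2) z
      rw [← huv, map_add] at h2
      refine Eq.trans ?_ h2
      abel

variable [IsManifold I ∞ M] [IsManifold J ∞ N]

theorem isNormalizedSubmanifold_prod (h : IsNormalizedSubmanifold I J ι ν) :
    IsNormalizedSubmanifold (I.prod 𝓘(ℝ, ℝ)) (J.prod 𝓘(ℝ, ℝ)) (Prod.map ι id : N × ℝ → M × ℝ)
      (liftNormal ν) where
  embedding := h.embedding.prodMap Manifold.IsSmoothEmbedding.id
  isCompl := isCompl_tangentTo_liftNormal (h.embedding.contMDiff.mdifferentiable (by simp))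
    h.isCompl
  smooth := by
    rintro ⟨y₀, τ₀⟩
    obtain ⟨U, hU, hy₀, k, s, hs, hspan⟩ := h.smooth y₀
    refine ⟨U ×ˢ Set.univ, hU.prod isOpen_univ, ⟨hy₀, trivial⟩, k,
      fun i q => horizontal (ι q.1, q.2) (s i q.1), fun i => ?_, ?_⟩
    · have h1 : ContMDiffOn (J.prod 𝓘(ℝ, ℝ)) I.tangent ∞
          (fun q : N × ℝ => (⟨ι q.1, s i q.1⟩ : TangentBundle I M)) (U ×ˢ Set.univ) :=
        (hs i).comp contMDiffOn_fst fun q hq => hq.1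
      have h2 : ContMDiffOn (J.prod 𝓘(ℝ, ℝ)) (𝓘(ℝ, ℝ)).tangent ∞
          (fun q : N × ℝ => (⟨q.2, 0⟩ : TangentBundle 𝓘(ℝ, ℝ) ℝ)) (U ×ˢ Set.univ) :=
        ((contMDiff_zeroSection ℝ (TangentSpace 𝓘(ℝ, ℝ))).comp contMDiff_snd).contMDiffOn
      exact ((contMDiff_equivTangentBundleProd_symm (n := ∞) (I := I) (I' := 𝓘(ℝ, ℝ)) (M := M)
        (M' := ℝ)).comp_contMDiffOn (h1.prodMk h2) :)
    · rintro ⟨y, τ⟩ ⟨hy, -⟩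
      obtain ⟨hli, hsp⟩ := hspan y hy
      have hinj : LinearMap.ker (horizontal (I := I) (ι y, τ)).toLinearMap = ⊥ :=
        LinearMap.ker_eq_bot_of_inverse (g := (baseComponent (I := I) (ι y, τ)).toLinearMap)
          (LinearMap.ext fun v => rfl)
      refine ⟨hli.map' _ hinj, ?_⟩
      change _ = (ν y).map (horizontal (I := I) (ι y, τ)).toLinearMap
      rw [← hsp, Submodule.map_span, ← Set.range_comp]
      rfl

/-- The contraction of `Π` with `α + a dτ` is `e^{-τ} (i(α)Λ + a R - α(R) ∂/∂τ)`; here `∂/∂τ` is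
tangent to `N × ℝ`, and `α ∈ ann(ν)` and `a ∈ ℝ` are arbitrary. -/
theorem isAJCSubmanifold_prod_iff (hN : IsNormalizedSubmanifold I J ι ν) :
    IsAJCSubmanifold J ι ν Λ R ↔ IsAJCSubmanifold (J.prod 𝓘(ℝ, ℝ))
      (Prod.map ι id : N × ℝ → M × ℝ) (liftNormal ν) (poissonization Λ R) 0 := by
  have hι : MDifferentiable J I ι := hN.embedding.contMDiff.mdifferentiable (by simp)
  constructor
  · intro h
    refine ⟨isNormalizedSubmanifold_prod hN, fun q α hα => ?_, fun q => Submodule.zero_mem _⟩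
    obtain ⟨w, hw, hwΛ⟩ := h.bivector q.1 (α.comp (horizontal (ι q.1, q.2)))
      fun v hv => hα _ (horizontal_mem_liftNormal hv)
    refine ⟨horizontal (ι q.1, q.2)
        (Real.exp (-q.2) • (w + α (dTau (ι q.1, q.2)) • R (ι q.1))) +
      (-(Real.exp (-q.2) * α (horizontal (ι q.1, q.2) (R (ι q.1))))) • dTau (ι q.1, q.2), ?_,
      fun β => ?_⟩
    · rw [mem_tangentTo_prod_iff hι, baseComponent_horizontal_add_dTau]
      exact Submodule.smul_mem _ _
        (Submodule.add_mem _ hw (Submodule.smul_mem _ _ (h.vector q.1)))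
    · have h1 := poissonization_apply Λ R (ι q.1, q.2) α β
      refine h1.trans ?_
      rw [hwΛ]
      simp only [map_smul, map_add, smul_eq_mul, ContinuousLinearMap.comp_apply]
      ring
  · intro h
    -- the tangency of the contraction of `Π` with `α + a dτ`, at the level `τ = 0`
    have key : ∀ (y : N) (α : Cotangent I (ι y)) (a : ℝ), Annihilates α (ν y) →
        ∃ w ∈ tangentTo I J ι y, ∀ β : Cotangent I (ι y), Λ (ι y) α β + a * β (R (ι y)) = β w := by
      intro y α a hα
      have hα' : Annihilates (prodCovector (ι y, (0 : ℝ)) α a) (liftNormal ν (y, (0 : ℝ))) := by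
        rintro _ ⟨v, hv, rfl⟩
        exact (prodCovector_horizontal (ι y, (0 : ℝ)) α a v).trans (hα v hv)
      obtain ⟨z, hz, hzp⟩ := h.bivector (y, 0) _ hα'
      refine ⟨_, (mem_tangentTo_prod_iff hι).1 hz, fun β => ?_⟩
      have h1 := (poissonization_prodCovector Λ R (ι y, 0) α β a 0).symm.trans (hzp _)
      have h2 := h1.trans (prodCovector_apply (ι y, (0 : ℝ)) β 0 z)
      simpa using h2
    refine ⟨hN, fun y α hα => ?_, fun y => ?_⟩
    · obtain ⟨w, hw, hwβ⟩ := key y α 0 hα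
      exact ⟨w, hw, fun β => by rw [← hwβ, zero_mul, add_zero]⟩
    · obtain ⟨w, hw, hwβ⟩ := key y 0 1 fun v _ => rfl
      have h2 : ∀ β : Cotangent I (ι y), β (R (ι y)) = β w := fun β => by
        have h3 := hwβ β
        rwa [map_zero, zero_apply, zero_add, one_mul] at h3
      have h1 : R (ι y) = w := by
        refine (SeparatingDual.eq_iff_forall_dual_eq (R := ℝ) (V := E)).2 fun β => ?_
        exact h2 β
      rwa [h1]

variable [FiniteDimensional ℝ E] [I.Boundaryless]

theorem isDiracSubmanifold_prod_iff [T2Space M] (hbi : IsBivectorField I Λ)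
    (hR : SmoothVectorField I R) (hN : IsNormalizedSubmanifold I J ι ν) :
    IsDiracSubmanifold J ι ν Λ R ↔ IsDiracSubmanifold (J.prod 𝓘(ℝ, ℝ))
      (Prod.map ι id : N × ℝ → M × ℝ) (liftNormal ν) (poissonization Λ R) 0 := by
  have hι : MDifferentiable J I ι := hN.embedding.contMDiff.mdifferentiable (by simp)
  have hbr : ∀ {X : ∀ x : M, TangentSpace I x}, SmoothVectorField I X → ∀ {f : M → ℝ},
      ContMDiff I 𝓘(ℝ, ℝ) ∞ f → ∀ x, derivAlong I X (derivAlong I R f) x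
        - derivAlong I R (derivAlong I X f) x = differential I f x (mlieBracket I X R x) :=
    fun hX f hf x => derivAlong_comm hf.contMDiffAt (hX.contMDiffAt.mdifferentiableAt (by simp))
      (hR.contMDiffAt.mdifferentiableAt (by simp))
  constructor
  · intro h
    have hajc := (isAJCSubmanifold_prod_iff hN).1 ⟨hN, h.bivector.1, h.vector.1⟩
    refine ⟨hajc.normalized, ⟨hajc.bivector, ?_⟩, ⟨hajc.vector, fun X _ q α _ => ?_⟩⟩
    · rintro X hX ⟨y, τ⟩ f g hf hg hfν hgν
      obtain ⟨hXs, hXν⟩ := isNormalField_prod_iff.1 hX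
      have hslice : IsNormalField ι ν (sliceVector X τ) :=
        ⟨hXs.sliceVector τ, fun y => (hXν y τ).1⟩
      have hsm : ∀ {f : M × ℝ → ℝ}, ContMDiff (I.prod 𝓘(ℝ, ℝ)) 𝓘(ℝ, ℝ) ∞ f →
          ContMDiff I 𝓘(ℝ, ℝ) ∞ fun x => f (x, τ) :=
        fun hf => hf.comp (contMDiff_id.prodMk contMDiff_const)
      -- `f` may be replaced by the function `f(·,τ) + aτ` with the same differential
      have hrep : ∀ {f : M × ℝ → ℝ}, ContMDiff (I.prod 𝓘(ℝ, ℝ)) 𝓘(ℝ, ℝ) ∞ f →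
          differential (I.prod 𝓘(ℝ, ℝ)) f (ι y, τ) =
            differential (I.prod 𝓘(ℝ, ℝ)) (addTau (fun x => f (x, τ))
              (differential (I.prod 𝓘(ℝ, ℝ)) f (ι y, τ) (dTau (ι y, τ)))) (ι y, τ) := by
        intro f hf
        have h1 := differential_comp_horizontal (hf.mdifferentiable (by simp) (ι y, τ))
        rw [differential_addTau (hsm hf), ← h1]
        exact eq_prodCovector _ _
      have hann : ∀ {f : M × ℝ → ℝ}, ContMDiff (I.prod 𝓘(ℝ, ℝ)) 𝓘(ℝ, ℝ) ∞ f →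
          Annihilates (differential (I.prod 𝓘(ℝ, ℝ)) f (ι y, τ)) (liftNormal ν (y, τ)) →
          Annihilates (differential I (fun x => f (x, τ)) (ι y)) (ν y) := by
        intro f hf hfν v hv
        have h1 := differential_comp_horizontal (hf.mdifferentiable (by simp) (ι y, τ))
        exact (DFunLike.congr_fun h1 v).symm.trans (hfν _ (horizontal_mem_liftNormal hv))
      have hL := lieDerivative_congr hXs (poissonization_alternating R hbi.alternating)
        (fun f g hf hg =>
          (contMDiffAt_poissonization_onFunctions hbi hR hf hg).mdifferentiableAt (by simp))
        (hf _) (contMDiff_addTau (hsm hf) _ _) (hg _) (contMDiff_addTau (hsm hg) _ _)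
        (hrep hf) (hrep hg)
      refine hL.trans ?_
      rw [lieDerivative_poissonization_addTau hbi hR hι h.bivector.1 h.vector.1 hX (hsm hf)
        (hsm hg) _ _ y τ (hann hf hfν) (hann hg hgν), hbr hslice.1 (hsm hf), hbr hslice.1 (hsm hg),
        h.bivector.2 _ hslice y _ _ (hsm hf) (hsm hg) (hann hf hfν) (hann hg hgν),
        h.vector.2 _ hslice y _ (hann hf hfν), h.vector.2 _ hslice y _ (hann hg hgν)]
      ring
    · rw [mlieBracket_zero_right]
      exact map_zero α
  · intro h
    have hajc := (isAJCSubmanifold_prod_iff hN).2 ⟨h.normalized, h.bivector.1, h.vector.1⟩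
    have hlift : ∀ {X : ∀ x : M, TangentSpace I x}, IsNormalField ι ν X →
        IsNormalField (Prod.map ι id : N × ℝ → M × ℝ) (liftNormal ν) (liftVector X) :=
      fun hX => ⟨smoothVectorField_liftVector hX.1, fun q => horizontal_mem_liftNormal (hX.2 q.1)⟩
    -- the Lie derivative of `Π` at the level `τ = 0`, along the lift of `X`
    have key : ∀ {X : ∀ x : M, TangentSpace I x}, IsNormalField ι ν X → ∀ (y : N) (f g : M → ℝ)
        (a : ℝ), ContMDiff I 𝓘(ℝ, ℝ) ∞ f → ContMDiff I 𝓘(ℝ, ℝ) ∞ g →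
        Annihilates (differential I f (ι y)) (ν y) → Annihilates (differential I g (ι y)) (ν y) →
        lieDerivative X Λ f g (ι y) + a * differential I g (ι y) (mlieBracket I X R (ι y)) = 0 := by
      intro X hX y f g a hf hg hfν hgν
      have hann : ∀ {f : M → ℝ}, ContMDiff I 𝓘(ℝ, ℝ) ∞ f → ∀ a : ℝ,
          Annihilates (differential I f (ι y)) (ν y) →
          Annihilates (differential (I.prod 𝓘(ℝ, ℝ)) (addTau f a) (ι y, (0 : ℝ)))
            (liftNormal ν (y, (0 : ℝ))) := by
        rintro f hf a hfν _ ⟨v, hv, rfl⟩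
        rw [differential_addTau hf]
        exact (prodCovector_horizontal (ι y, (0 : ℝ)) _ a v).trans (hfν v hv)
      have h1 := h.bivector.2 _ (hlift hX) (y, 0) _ _ (contMDiff_addTau hf a) (contMDiff_addTau hg 0)
        (hann hf a hfν) (hann hg 0 hgν)
      have h2 := lieDerivative_poissonization_addTau hbi hR hι hajc.bivector hajc.vector (hlift hX)
        hf hg a 0 y 0 hfν hgν
      have h3 : sliceVector (liftVector X) (0 : ℝ) = X := rfl
      rw [h3, hbr hX.1 hg] at h2
      simpa using h2.symm.trans h1
    refine ⟨hN, ⟨hajc.bivector, fun X hX y f g hf hg hfν hgν => ?_⟩,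
      ⟨hajc.vector, fun X hX y α hα => ?_⟩⟩
    · simpa using key hX y f g 0 hf hg hfν hgν
    · -- comparing `dg` with `dg + dτ` isolates the bracket `[X, R]`
      obtain ⟨g, hg, rfl⟩ := exists_differential_eq (ι y) α
      have h0 := key hX y g g 0 hg hg hα hα
      have h1 := key hX y g g 1 hg hg hα hα
      linarith

end Equivalence

end JacobiDirac

end

theorem proposition3p3
    {E : Type*} [NormedAddCommGroup E] [NormedSpace ℝ E] [FiniteDimensional ℝ E]
    {H : Type*} [TopologicalSpace H] (I : ModelWithCorners ℝ E H) [I.Boundaryless]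
    {M : Type*} [TopologicalSpace M] [T2Space M] [ChartedSpace H M] [IsManifold I ∞ M]
    {E' : Type*} [NormedAddCommGroup E'] [NormedSpace ℝ E'] [FiniteDimensional ℝ E']
    {H' : Type*} [TopologicalSpace H'] (J : ModelWithCorners ℝ E' H') [J.Boundaryless]
    {N : Type*} [TopologicalSpace N] [ChartedSpace H' N] [IsManifold J ∞ N]
    (Λ : JacobiDirac.CotensorField I M) (R : ∀ x : M, TangentSpace I x)
    (hM : JacobiDirac.IsJacobiStructure Λ R)
    (ι : N → M) (ν : ∀ y : N, Submodule ℝ (TangentSpace I (ι y)))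
    (hN : JacobiDirac.IsNormalizedSubmanifold I J ι ν) :
    JacobiDirac.IsNormalizedSubmanifold (I.prod 𝓘(ℝ, ℝ)) (J.prod 𝓘(ℝ, ℝ))
      (Prod.map ι id : N × ℝ → M × ℝ) (JacobiDirac.liftNormal ν) ∧
    (JacobiDirac.IsAJCSubmanifold J ι ν Λ R ↔
      JacobiDirac.IsAJCSubmanifold (J.prod 𝓘(ℝ, ℝ)) (Prod.map ι id : N × ℝ → M × ℝ)
        (JacobiDirac.liftNormal ν) (JacobiDirac.poissonization Λ R) 0) ∧
    (JacobiDirac.IsDiracSubmanifold J ι ν Λ R ↔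
      JacobiDirac.IsDiracSubmanifold (J.prod 𝓘(ℝ, ℝ)) (Prod.map ι id : N × ℝ → M × ℝ)
        (JacobiDirac.liftNormal ν) (JacobiDirac.poissonization Λ R) 0) :=
  ⟨JacobiDirac.isNormalizedSubmanifold_prod hN, JacobiDirac.isAJCSubmanifold_prod_iff hN,
    JacobiDirac.isDiracSubmanifold_prod_iff hM.bivector hM.smooth hN⟩
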